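/- Let $w_0,\dots,w_{\beta-1}$ be any finite collection of strings (documents), of total length $n$, and let $T$ be their generalised suffix tree, i.e. the compacted trie of all suffixes of $w_0\$_0,\dots,w_{\beta-1}\$_{\beta-1}$, where the $\$_k$ are distinct characters that occur in no document. A (possibly implicit) node of $T$ is identified with the string that it represents; it is explicit if it is the root, a leaf, or has at least two children in the uncompacted trie. Every explicit node has a pointer, and the pointers are arbitrary distinct machine words. Let $\ell$ be a natural number, let $r$ be a primitive string (not of the form $v^i$ with $i>1$) with $|r|\le \ell/4$, let $T_r$ be the part of $T$ that consists of all nodes representing substrings of $r^\infty$ of length at least $\ell/2$, and let $s$ be the number of explicit nodes in $T_r$. Work in the word-RAM model with logarithmic word size: words have $W\ge\kappa\log_2 n$ bits, where $\kappa$ is an absolute constant. Then $T_r$ has a static data structure of $O(|r|\log|r|+s+1)$ words such that, in $O(1)$ worst-case time, the node corresponding to any substring $x$ of $r^\infty$ of length at least $\frac34\ell$ that is represented in $T$ can be retrieved. In detail: there are a single word-RAM program and absolute constants $C,\kappa$ such that for all data as above there is an array $D$ of at most $C(|r|\log_2|r|+s+1)$ words with the following property. For each such $x$, given by a starting position $0\le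 i<|r|$ in $r^\infty$ and its length $|x|$, the program, run on the memory image $D$ with arguments $i$ and $|x|$, stops after at most $C$ steps, leaves the memory as it was, and reports whether the node of $x$ is explicit, together with the pointer to this node if it is explicit, and otherwise with the pointer to the lower endpoint of the edge of $T$ on which it lies (which identifies that edge). -/

import Mathlib

/-! ## Strings -/

/-- The `i`-th power `v v ... v` of a string. -/
def strPow {α : Type*} (v : List α) (i : ℕ) : List α := (List.replicate i v).flatten

/-- A string is primitive if it is not `v ^ i` with `i > 1` (so the empty string is not primitive). -/
def IsPrimitive {α : Type*} (u : List α) : Prop :=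
  ∀ (v : List α) (i : ℕ), 1 < i → u ≠ strPow v i

/-- `x` is the substring of `r r r ...` (infinitely often) that starts at (0-based) position `i`
and has length `x.length`. -/
def OccursInPowAt {α : Type*} (r : List α) (i : ℕ) (x : List α) : Prop :=
  ∀ j < x.length, x[j]? = r[(i + j) % r.length]?

/-! ## Compacted tries and generalised suffix trees

A node of a trie, implicit or explicit, is identified with the string it represents. -/

/-- The nodes, implicit and explicit, of the (compacted) trie of a set of strings. -/
def trieNodes {β : Type*} (S : Set (List β)) : Set (List β) := {u | ∃ x ∈ S, u <+: x}

/-- A node of the compacted trie is explicit if it is the root, or a leaf (no child), or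
branching (at least two children). -/
def IsExplicitNode {β : Type*} (S : Set (List β)) (u : List β) : Prop :=
  u ∈ trieNodes S ∧ (u = [] ∨ ¬ ∃! c : β, u ++ [c] ∈ trieNodes S)

/-- `v` is the topmost explicit node in the subtree of `u` (including `u` itself): it is `u` if `u`
is explicit, and otherwise the lower endpoint of the edge on which the implicit node `u` lies. -/
def IsLocus {β : Type*} (S : Set (List β)) (u v : List β) : Prop :=
  IsExplicitNode S v ∧ u <+: v ∧ ∀ v', IsExplicitNode S v' → u <+: v' → v <+: v'

/-- A string over the alphabet `α`, as a string over `α` extended by separators. -/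
def plain {α : Type*} (x : List α) : List (α ⊕ ℕ) := x.map Sum.inl

/-- All suffixes of `w₀ $₀, w₁ $₁, ...`, where `docs = [w₀, w₁, ...]` and `$ₖ = Sum.inr k`. The
generalised suffix tree of `docs` is the compacted trie of this set. -/
def gstSuffixes {α : Type*} (docs : List (List α)) : Set (List (α ⊕ ℕ)) :=
  {x | ∃ (k : ℕ) (w : List α), docs[k]? = some w ∧ x <:+ plain w ++ [Sum.inr k]}

/-- The nodes of `T_r`: the nodes of the generalised suffix tree of `docs` that represent
substrings of `r r r ...` of length at least `ℓ / 2`. -/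
def periodicPart {α : Type*} (docs : List (List α)) (r : List α) (ℓ : ℕ) : Set (List (α ⊕ ℕ)) :=
  {u | u ∈ trieNodes (gstSuffixes docs) ∧
    ∃ (x : List α) (i : ℕ), u = plain x ∧ OccursInPowAt r i x ∧ ℓ ≤ 2 * x.length}

/-- The number of explicit nodes in `T_r`. -/
noncomputable def numExplicitPeriodic {α : Type*} (docs : List (List α)) (r : List α) (ℓ : ℕ) : ℕ :=
  {u | u ∈ periodicPart docs r ℓ ∧ IsExplicitNode (gstSuffixes docs) u}.ncard

/-! ## The word RAM -/

namespace WordRAM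

/-- The binary operations of the word RAM. -/
inductive BinOp where
  | add | sub | mul | div | mod | and | or | xor | shl | shr | eq | lt

/-- Operations on words of `W` bits, represented by natural numbers below `2 ^ W`; arithmetic is
modulo `2 ^ W`, and comparisons return 0 or 1. -/
def BinOp.eval (W : ℕ) (o : BinOp) (x y : ℕ) : ℕ :=
  match o with
  | .add => (x + y) % 2 ^ W
  | .sub => (x + (2 ^ W - y % 2 ^ W)) % 2 ^ W
  | .mul => (x * y) % 2 ^ W
  | .div => (x / y) % 2 ^ W
  | .mod => (x % y) % 2 ^ W
  | .and => (Nat.land x y) % 2 ^ W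
  | .or => (Nat.lor x y) % 2 ^ W
  | .xor => (Nat.xor x y) % 2 ^ W
  | .shl => (Nat.shiftLeft x y) % 2 ^ W
  | .shr => (Nat.shiftRight x y) % 2 ^ W
  | .eq => (if x = y then 1 else 0) % 2 ^ W
  | .lt => (if x < y then 1 else 0) % 2 ^ W

/-- The instructions; `d`, `a`, `b` are numbers of registers and `t` is a position in the program.
`const d c`: put `c` into `d`. `op o d a b`: put the result of `o` on `a` and `b` into `d`.
`load d a`: put the memory word whose address is in `a` into `d`. `store a b`: put the content of
`b` into the memory word whose address is in `a`. `jump t`: go to `t`. `jumpZero a t`: go to `t` if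
`a` contains 0. -/
inductive Instr where
  | const (d c : ℕ)
  | op (o : BinOp) (d a b : ℕ)
  | load (d a : ℕ)
  | store (a b : ℕ)
  | jump (t : ℕ)
  | jumpZero (a t : ℕ)
  | halt

/-- A program is a finite list of instructions; it mentions finitely many registers. -/
abbrev Program := List Instr

/-- A configuration: program counter, registers, memory. -/
structure Config where
  pc : ℕ
  reg : ℕ → ℕ
  mem : ℕ → ℕ

/-- The machine has stopped: it is at a `halt` or outside the program. -/
def Halted (P : Program) (s : Config) : Prop := P[s.pc]? = none ∨ P[s.pc]? = some Instr.halt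

/-- One step of computation (unit cost), with words of `W` bits. -/
def step (W : ℕ) (P : Program) (s : Config) : Config :=
  match P[s.pc]? with
  | none => s
  | some .halt => s
  | some (.const d c) => ⟨s.pc + 1, Function.update s.reg d (c % 2 ^ W), s.mem⟩
  | some (.op o d a b) =>
      ⟨s.pc + 1, Function.update s.reg d (o.eval W (s.reg a) (s.reg b)), s.mem⟩
  | some (.load d a) => ⟨s.pc + 1, Function.update s.reg d (s.mem (s.reg a)), s.mem⟩
  | some (.store a b) => ⟨s.pc + 1, s.reg, Function.update s.mem (s.reg a) (s.reg b)⟩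
  | some (.jump t) => ⟨t, s.reg, s.mem⟩
  | some (.jumpZero a t) => ⟨if s.reg a = 0 then t else s.pc + 1, s.reg, s.mem⟩

/-- The configuration after `t` steps. -/
def run (W : ℕ) (P : Program) (t : ℕ) (s : Config) : Config := (step W P)^[t] s

/-- The memory that contains the words of `D` at the addresses `0, 1, ...` and 0 elsewhere. -/
def memOf (D : List ℕ) : ℕ → ℕ := fun a => D.getD a 0

/-- The start of a computation on the memory image `D` with arguments `x` and `y` in
registers 0 and 1; all other registers contain 0. -/
def start (D : List ℕ) (x y : ℕ) : Config :=
  ⟨0, fun k => if k = 0 then x else if k = 1 then y else 0, memOf D⟩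

/-- On memory image `D` and arguments `x`, `y`, the program stops after at most `c` steps with
`out₀` in register 0 and `out₁` in register 1, and with the memory as it was at the start. -/
def AnswersWithin (W : ℕ) (P : Program) (c : ℕ) (D : List ℕ) (x y out₀ out₁ : ℕ) : Prop :=
  ∃ t ≤ c, Halted P (run W P t (start D x y)) ∧
    (run W P t (start D x y)).reg 0 = out₀ ∧
    (run W P t (start D x y)).reg 1 = out₁ ∧
    (run W P t (start D x y)).mem = memOf D

end WordRAM

/-! ## Tries and loci -/

/-! Put p = |r| and B = ⌈ℓ/2⌉, and sort the substrings of r^∞ of length B + y by the residue class c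
mod p of their end position. Deleting the first letter keeps c and lowers y by one. Suffixes of
explicit nodes are explicit (`isExplicitNode_of_cons`), so the explicit nodes of class c are exactly
those with y < h c (`isExplicitNode_classWindow_iff`), and p heights decide explicitness. Since r is
primitive and B ≥ p, distinct pairs (c, y) give distinct strings, so ∑ h c ≤ s
(`sum_explicitHeight_le`).

Appending the next letter of r^∞ moves (c, y) to (c + 1, y + 1). At an implicit node this does not
change the locus (`windowLocus_succ`), so the answer A is constant along a diagonal as long as y ≥ h
c (`diagonal_shift`).

Cut the values y into blocks of length p, and let b = y / p. If some height exceeds bp, let k < p be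
least with h (c + k) > bp; then A c y = A (c + k) (y + k). Long queries have y ≥ p, so b ≥ 1 and y +
k < (b + 2)p ≤ 3bp < 3 h (c + k): an array of length 3 h c per class suffices. The shift k depends
only on (b, c), which takes fewer than max h + p table entries. If no height exceeds bp, the answer
depends only on the start i. In all this is O(p + s + 1) words. -/

theorem mem_trieNodes_of_prefix {β : Type*} {S : Set (List β)} {u v : List β}
    (h : u <+: v) (hv : v ∈ trieNodes S) : u ∈ trieNodes S := by
  obtain ⟨x, hx, hvx⟩ := hv
  exact ⟨x, hx, h.trans hvx⟩

theorem IsLocus.unique {β : Type*} {S : Set (List β)} {u v v' : List β}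
    (h : IsLocus S u v) (h' : IsLocus S u v') : v = v' := by
  have h1 := h.2.2 v' h'.1 h'.2.1
  have h2 := h'.2.2 v h.1 h.2.1
  exact h1.eq_of_length (le_antisymm h1.length_le h2.length_le)

theorem IsExplicitNode.isLocus_self {β : Type*} {S : Set (List β)} {u : List β}
    (h : IsExplicitNode S u) : IsLocus S u u :=
  ⟨h, List.prefix_rfl, fun _ _ h => h⟩

/-- An implicit node and its child have the same locus. -/
theorem IsLocus.of_child {β : Type*} {S : Set (List β)} {u v : List β} {c : β}
    (hu : ¬ IsExplicitNode S u) (hc : u ++ [c] ∈ trieNodes S) (h : IsLocus S (u ++ [c]) v) :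
    IsLocus S u v := by
  refine ⟨h.1, (List.prefix_append _ _).trans h.2.1, fun v' hv' huv' => h.2.2 v' hv' ?_⟩
  have hmem : u ∈ trieNodes S := mem_trieNodes_of_prefix (List.prefix_append _ _) hc
  have huniq : ∃! c : β, u ++ [c] ∈ trieNodes S := by
    by_contra hne
    exact hu ⟨hmem, Or.inr hne⟩
  obtain ⟨t, rfl⟩ := huv'
  cases t with
  | nil => exact absurd (by simpa using hv') hu
  | cons d t =>
    have hd : u ++ [d] ∈ trieNodes S :=
      mem_trieNodes_of_prefix ⟨t, by simp⟩ hv'.1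
    rw [huniq.unique hc hd]
    exact ⟨t, by simp⟩

theorem exists_isLocus {β : Type*} {S : Set (List β)} {N : ℕ}
    (hN : ∀ u ∈ trieNodes S, u.length ≤ N) {u : List β} (hu : u ∈ trieNodes S) :
    ∃ v, IsLocus S u v := by
  induction hk : N - u.length using Nat.strong_induction_on generalizing u with
  | _ k ih =>
    by_cases he : IsExplicitNode S u
    · exact ⟨u, he.isLocus_self⟩
    · have huniq : ∃! c : β, u ++ [c] ∈ trieNodes S := by
        by_contra hne
        exact he ⟨hu, Or.inr hne⟩
      obtain ⟨c, hc, -⟩ := huniq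
      have hlen := hN _ hc
      simp only [List.length_append, List.length_singleton] at hlen
      obtain ⟨v, hv⟩ := ih (N - (u ++ [c]).length)
        (by simp only [List.length_append, List.length_singleton]; omega) hc rfl
      exact ⟨v, hv.of_child he hc⟩

/-! ## Generalised suffix trees -/

theorem mem_trieNodes_gst_of_cons {α : Type*} {docs : List (List α)} {a : α ⊕ ℕ}
    {u : List (α ⊕ ℕ)} (h : a :: u ∈ trieNodes (gstSuffixes docs)) :
    u ∈ trieNodes (gstSuffixes docs) := by
  obtain ⟨x, ⟨k, w, hk, hx⟩, t, rfl⟩ := h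
  exact ⟨u ++ t, ⟨k, w, hk, (List.suffix_cons a (u ++ t)).trans hx⟩, List.prefix_append _ _⟩

theorem length_le_of_mem_trieNodes_gst {α : Type*} {docs : List (List α)} {u : List (α ⊕ ℕ)}
    (h : u ∈ trieNodes (gstSuffixes docs)) : u.length ≤ (docs.map List.length).sum + 1 := by
  obtain ⟨x, ⟨k, w, hk, hx⟩, hux⟩ := h
  have h1 := hux.length_le
  have h2 := hx.length_le
  have h3 : w.length ≤ (docs.map List.length).sum :=
    List.le_sum_of_mem (List.mem_map_of_mem (List.mem_of_getElem? hk))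
  simp only [plain, List.length_append, List.length_map, List.length_singleton] at h2
  omega

/-- Every nonempty suffix in the set ends in a separator, so a nonempty separator-free node is never
a leaf: for such nodes, explicit means branching. -/
theorem exists_child_of_plain {α : Type*} {docs : List (List α)} {x : List α}
    (hne : x ≠ []) (h : plain x ∈ trieNodes (gstSuffixes docs)) :
    ∃ c, plain x ++ [c] ∈ trieNodes (gstSuffixes docs) := by
  obtain ⟨y, hy, t, rfl⟩ := h
  cases t with
  | cons c t => exact ⟨c, _, hy, t, by simp⟩
  | nil =>
    exfalso
    obtain ⟨k, w, hk, s, hs⟩ := hy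
    have hx : plain x ≠ [] := by simpa [plain] using hne
    have h1 : (plain x).getLast hx = Sum.inr k := by
      have := congrArg List.getLast? hs
      simp only [List.append_nil, List.getLast?_append, List.getLast?_singleton,
        List.getLast?_eq_some_getLast hx] at this
      simpa using this
    have h2 := List.getLast_mem hx
    rw [h1] at h2
    simp [plain] at h2

theorem length_le_of_plain_mem {α : Type*} {docs : List (List α)} {x : List α}
    (h : plain x ∈ trieNodes (gstSuffixes docs)) : x.length ≤ (docs.map List.length).sum := by
  by_cases hne : x = []
  · simp [hne]
  · obtain ⟨c, hc⟩ := exists_child_of_plain hne h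
    have := length_le_of_mem_trieNodes_gst hc
    simpa [plain] using this

/-- Suffixes of explicit nodes of a suffix tree are explicit. -/
theorem isExplicitNode_of_cons {α : Type*} {docs : List (List α)} {a : α} {x : List α}
    (h : IsExplicitNode (gstSuffixes docs) (plain (a :: x))) :
    IsExplicitNode (gstSuffixes docs) (plain x) := by
  have hcons : plain (a :: x) = Sum.inl a :: plain x := rfl
  -- Children of the longer string are children of its suffix, so a unique child of the suffix would
  -- be the unique child of the longer string.
  refine ⟨mem_trieNodes_gst_of_cons (hcons ▸ h.1), Or.inr fun ⟨d, hd, huniq⟩ => ?_⟩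
  obtain ⟨c, hc⟩ := exists_child_of_plain (List.cons_ne_nil a x) h.1
  rcases h.2 with h2 | h2
  · simp [plain] at h2
  · refine h2 ⟨c, hc, fun c' hc' => ?_⟩
    rw [huniq c' (mem_trieNodes_gst_of_cons (a := Sum.inl a) (by simpa [hcons] using hc')),
      huniq c (mem_trieNodes_gst_of_cons (a := Sum.inl a) (by simpa [hcons] using hc))]

/-! ## Substrings of a periodic string -/

/-- The string `f i, f (i + 1), ...` of length `m`. -/
def window {α : Type*} (f : ℕ → α) (i m : ℕ) : List α := (List.range' i m).map f

section window

variable {α : Type*} (f : ℕ → α)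

@[simp] theorem length_window (i m : ℕ) : (window f i m).length = m := by simp [window]

theorem window_succ (i m : ℕ) : window f i (m + 1) = f i :: window f (i + 1) m := by
  simp [window, List.range'_succ]

theorem window_concat (i m : ℕ) : window f i (m + 1) = window f i m ++ [f (i + m)] := by
  simp [window, List.range'_concat]

theorem getElem?_window {i m j : ℕ} (h : j < m) : (window f i m)[j]? = some (f (i + j)) := by
  simp [window, h]

theorem window_prefix {i m m' : ℕ} (h : m ≤ m') : window f i m <+: window f i m' := by
  induction h with
  | refl => exact List.prefix_rfl
  | step _ ih => exact ih.trans (by rw [window_concat]; exact List.prefix_append _ _)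

variable {f}

theorem window_congr {i i' m : ℕ} (h : ∀ j, f (i + j) = f (i' + j)) :
    window f i m = window f i' m := by
  apply List.ext_getElem?
  intro j
  by_cases hj : j < m
  · rw [getElem?_window f hj, getElem?_window f hj, h]
  · rw [List.getElem?_eq_none (by simpa using hj), List.getElem?_eq_none (by simpa using hj)]

end window

/-- The infinite power of a nonempty string, as a function of the position. -/
def infPow {α : Type*} (r : List α) (hr : 0 < r.length) (j : ℕ) : α :=
  r[j % r.length]'(Nat.mod_lt _ hr)

theorem infPow_add_mul {α : Type*} (r : List α) (hr : 0 < r.length) (j k : ℕ) :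
    infPow r hr (j + r.length * k) = infPow r hr j := by
  simp [infPow, Nat.add_mul_mod_self_left]

theorem infPow_mod {α : Type*} (r : List α) (hr : 0 < r.length) (j : ℕ) :
    infPow r hr (j % r.length) = infPow r hr j := by
  simp [infPow]

theorem OccursInPowAt.eq_window {α : Type*} {r : List α} (hr : 0 < r.length) {i : ℕ}
    {x : List α} (h : OccursInPowAt r i x) : x = window (infPow r hr) i x.length := by
  apply List.ext_getElem?
  intro j
  by_cases hj : j < x.length
  · rw [getElem?_window _ hj, h j hj, infPow, List.getElem?_eq_getElem]
  · rw [List.getElem?_eq_none (by simpa using hj), List.getElem?_eq_none (by simpa using hj)]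

theorem occursInPowAt_window {α : Type*} {r : List α} (hr : 0 < r.length) (i m : ℕ) :
    OccursInPowAt r i (window (infPow r hr) i m) := by
  intro j hj
  rw [length_window] at hj
  rw [getElem?_window _ hj, infPow, List.getElem?_eq_getElem]

theorem IsPrimitive.length_pos {α : Type*} {r : List α} (h : IsPrimitive r) : 0 < r.length := by
  rcases r with _ | ⟨a, r⟩
  · exact absurd (by simp [strPow]) (h [] 2 one_lt_two)
  · simp

theorem getElem?_strPow {α : Type*} (v : List α) (m : ℕ) {j : ℕ} (hj : j < m * v.length) :
    (strPow v m)[j]? = v[j % v.length]? := by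
  induction m generalizing j with
  | zero => simp at hj
  | succ m ih =>
    rw [strPow, List.replicate_succ, List.flatten_cons]
    by_cases h : j < v.length
    · rw [List.getElem?_append_left h, Nat.mod_eq_of_lt h]
    · rw [List.getElem?_append_right (by omega), ← strPow, ih, ← Nat.mod_eq_sub_mod (by omega)]
      rw [Nat.succ_mul] at hj
      omega

/-- A primitive string differs from its proper rotations. -/
theorem IsPrimitive.dvd_of_shift {α : Type*} {r : List α} (h : IsPrimitive r)
    {d : ℕ} (hd : ∀ j, infPow r h.length_pos (j + d) = infPow r h.length_pos j) :
    r.length ∣ d := by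
  set p := r.length with hp
  have hpos : 0 < p := h.length_pos
  set f := infPow r h.length_pos with hf
  have hmul : ∀ k j, f (j + k * d) = f j := by
    intro k
    induction k with
    | zero => simp
    | succ k ih => intro j; rw [Nat.succ_mul, ← add_assoc, hd, ih]
  by_contra hnd
  have hlt : Nat.gcd d p < p := (Nat.gcd_le_right d hpos).lt_of_ne fun he =>
    hnd (he ▸ Nat.gcd_dvd_left d p)
  -- Bézout without negative coefficients: the gcd is a multiple of d reduced mod p, hence also a
  -- period.
  have hg : ∀ j, f (j + Nat.gcd d p) = f j := by
    intro j
    obtain ⟨k, -, hk⟩ := Nat.exists_mul_mod_eq_gcd hlt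
    rw [← hk, ← hmul k j, hf, ← infPow_add_mul r _ (j + d * k % p) (d * k / p), add_assoc, ← hp,
      Nat.mod_add_div, mul_comm d k]
  set g := Nat.gcd d p with hgdef
  have hgpos : 0 < g := Nat.gcd_pos_of_pos_right _ hpos
  obtain ⟨m, hm⟩ : g ∣ p := Nat.gcd_dvd_right d p
  have hm1 : 1 < m := by
    by_contra hle
    have : m = 0 ∨ m = 1 := by omega
    rcases this with rfl | rfl <;> omega
  have hgmul : ∀ k j, f (j + g * k) = f j := by
    intro k
    induction k with
    | zero => simp
    | succ k ih => intro j; rw [Nat.mul_succ, ← add_assoc, hg, ih]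
  have hgp : g ≤ p := hlt.le
  have hlen : (r.take g).length = g := by rw [List.length_take]; omega
  refine h (r.take g) m hm1 (List.ext_getElem? fun j => ?_)
  by_cases hj : j < p
  · rw [getElem?_strPow _ _ (by rw [hlen, mul_comm, ← hm]; exact hj), hlen]
    have hjg : j % g < g := Nat.mod_lt _ hgpos
    rw [List.getElem?_take_of_lt hjg]
    have h1 := hgmul (j / g) (j % g)
    rw [Nat.mod_add_div] at h1
    simp only [hf, infPow, ← hp, Nat.mod_eq_of_lt hj, Nat.mod_eq_of_lt (hjg.trans_le hgp)] at h1
    rw [List.getElem?_eq_getElem hj, List.getElem?_eq_getElem (hjg.trans_le hgp), h1]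
  · rw [List.getElem?_eq_none (by omega), List.getElem?_eq_none]
    simp only [strPow, List.length_flatten, List.map_replicate, hlen, List.sum_replicate,
      smul_eq_mul]
    rw [mul_comm, ← hm]; omega

/-- In the infinite power of a primitive string `r`, a window of length at least `|r|` determines
its position modulo `|r|`. -/
theorem IsPrimitive.window_inj {α : Type*} {r : List α} (h : IsPrimitive r) {i i' m : ℕ}
    (hm : r.length ≤ m)
    (heq : window (infPow r h.length_pos) i m = window (infPow r h.length_pos) i' m) :
    i ≡ i' [MOD r.length] := by
  wlog hle : i ≤ i' generalizing i i'
  · exact (this heq.symm (le_of_not_ge hle)).symm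
  have hpos := h.length_pos
  refine (Nat.modEq_iff_dvd' hle).2 (h.dvd_of_shift fun j => ?_)
  have key : ∀ k, infPow r hpos (i + k) = infPow r hpos (i' + k) := by
    intro k
    have hk : k % r.length < m := (Nat.mod_lt _ hpos).trans_le hm
    have h1 := congrArg (fun l => l[k % r.length]?) heq
    simp only [getElem?_window _ hk, Option.some.injEq] at h1
    rw [← Nat.mod_add_div k r.length, ← add_assoc, ← add_assoc, infPow_add_mul, infPow_add_mul, h1]
  -- This offset turns the start i into a multiple of p, which drops out.
  have e1 := key (j + (r.length * i - i))
  have hi : i ≤ r.length * i := Nat.le_mul_of_pos_left i hpos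
  rw [show i + (j + (r.length * i - i)) = j + r.length * i by omega,
    show i' + (j + (r.length * i - i)) = j + (i' - i) + r.length * i by omega,
    infPow_add_mul, infPow_add_mul] at e1
  exact e1.symm

/-! ### The query program and its correctness -/

namespace WordRAM

/-- The query program. On a memory image that starts with `p`, `B`, `K`, `q`, it computes from the
arguments `i` and `m` the values `y = m - B`, `c = (i + m) % p` and `b = y / p`, and looks up the
tag and the pointer. -/
def lookupProgram : Program :=
  -- Register 20 is never written: its 0 serves as the address of p and, in the `eq` instruction,
  -- negates the test y < h c to give the tag.
  [.load 2 20, .const 3 1, .load 4 3, .op .sub 5 1 4, .op .add 6 0 1, .op .mod 6 6 2,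
   .const 8 4, .op .add 7 6 8, .load 7 7, .op .lt 9 5 7, .op .eq 1 9 20,
   .op .div 10 5 2, .const 3 2, .load 11 3, .op .lt 12 10 11, .jumpZero 12 24,
   .op .mul 10 10 2, .op .add 10 10 6, .const 3 3, .load 11 3, .op .add 10 10 11, .load 10 10,
   .op .add 10 10 5, .jump 26,
   .op .add 10 0 2, .op .add 10 10 8,
   .load 0 10, .halt]

theorem lookupProgram_answersWithin {W : ℕ} {D : List ℕ} {i m p B K q h ptr : ℕ}
    (hp0 : memOf D 0 = p) (hB1 : memOf D 1 = B) (hK : memOf D 2 = K) (hq : memOf D 3 = q)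
    (hW : 16 ≤ 2 ^ W) (hBm : B ≤ m) (him : i + m < 2 ^ W)
    (hc : (i + m) % p + 4 < 2 ^ W)
    (hh : memOf D ((i + m) % p + 4) = h)
    (hlow : (m - B) / p < K → ∃ g, (m - B) / p * p + (i + m) % p + q < 2 ^ W ∧
      memOf D ((m - B) / p * p + (i + m) % p + q) = g ∧ g + (m - B) < 2 ^ W ∧
      memOf D (g + (m - B)) = ptr)
    (hhigh : K ≤ (m - B) / p → i + p + 4 < 2 ^ W ∧ memOf D (i + p + 4) = ptr) :
    AnswersWithin W lookupProgram 40 D i m ptr (if m - B < h then 0 else 1) := by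
  have e1 : 1 % 2 ^ W = 1 := Nat.mod_eq_of_lt (by omega)
  have e2 : 2 % 2 ^ W = 2 := Nat.mod_eq_of_lt (by omega)
  have e3 : 3 % 2 ^ W = 3 := Nat.mod_eq_of_lt (by omega)
  have e4 : 4 % 2 ^ W = 4 := Nat.mod_eq_of_lt (by omega)
  have esub : (m + (2 ^ W - B % 2 ^ W)) % 2 ^ W = m - B := by
    rw [Nat.mod_eq_of_lt (by omega : B < 2 ^ W),
      show m + (2 ^ W - B) = (m - B) + 2 ^ W by omega, Nat.add_mod_right]
    exact Nat.mod_eq_of_lt (by omega)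
  have eadd : (i + m) % 2 ^ W = i + m := Nat.mod_eq_of_lt him
  have emod : (i + m) % p % 2 ^ W = (i + m) % p := Nat.mod_eq_of_lt (by omega)
  have eadd4 : ((i + m) % p + 4) % 2 ^ W = (i + m) % p + 4 := Nat.mod_eq_of_lt hc
  have hdivle := Nat.div_le_self (m - B) p
  have ediv : (m - B) / p % 2 ^ W = (m - B) / p := Nat.mod_eq_of_lt (by omega)
  have hreg1 : (if (if m - B < h then 1 else 0) % 2 ^ W = 0 then 1 else 0) % 2 ^ W =
      if m - B < h then 0 else 1 := by
    split_ifs <;> simp_all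
  generalize hc' : (i + m) % p = c at *
  generalize hy' : m - B = y at *
  generalize hb' : y / p = b at *
  -- The first 15 instructions are common to both branches; the first conjunct only fixes the
  -- program counter and the memory.
  have hprefix : run W lookupProgram 15 (start D i m) =
      ⟨15, (run W lookupProgram 15 (start D i m)).reg, memOf D⟩ ∧
      (run W lookupProgram 15 (start D i m)).reg 0 = i ∧
      (run W lookupProgram 15 (start D i m)).reg 1 = (if y < h then 0 else 1) ∧
      (run W lookupProgram 15 (start D i m)).reg 2 = p ∧
      (run W lookupProgram 15 (start D i m)).reg 5 = y ∧
      (run W lookupProgram 15 (start D i m)).reg 6 = c ∧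
      (run W lookupProgram 15 (start D i m)).reg 8 = 4 ∧
      (run W lookupProgram 15 (start D i m)).reg 10 = b ∧
      (run W lookupProgram 15 (start D i m)).reg 12 = (if b < K then 1 else 0) % 2 ^ W := by
    simp [run, start, step, lookupProgram, BinOp.eval, hp0, hB1, hK, e1, e2, e4, esub, eadd, hc', emod, eadd4, hh, hreg1, hb', ediv]
  obtain ⟨hs, g0, g1, g2, g5, g6, g8, g10, g12⟩ := hprefix
  have hrun : ∀ t, run W lookupProgram (t + 15) (start D i m) =
      run W lookupProgram t (run W lookupProgram 15 (start D i m)) := fun t =>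
    Function.iterate_add_apply _ _ _ _
  generalize run W lookupProgram 15 (start D i m) = s at *
  obtain ⟨pc, reg, mem⟩ := s
  simp only [Config.mk.injEq, true_and] at hs
  obtain ⟨rfl, rfl⟩ := hs
  simp only at g0 g1 g2 g5 g6 g8 g10 g12
  by_cases hbK : b < K
  · obtain ⟨g, a1, a2, a3, a4⟩ := hlow hbK
    have m1 : b * p % 2 ^ W = b * p := Nat.mod_eq_of_lt (by omega)
    have m2 : (b * p + c) % 2 ^ W = b * p + c := Nat.mod_eq_of_lt (by omega)
    have m3 : (b * p + c + q) % 2 ^ W = b * p + c + q := Nat.mod_eq_of_lt a1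
    have m4 : (g + y) % 2 ^ W = g + y := Nat.mod_eq_of_lt a3
    rw [if_pos hbK, e1] at g12
    refine ⟨10 + 15, by norm_num, ?_⟩
    rw [hrun]
    simp [Halted, run, step, lookupProgram, BinOp.eval, g1, g2, g5, g6, g10, g12, hq, e3, m1, m2, m3, m4, a2, a4]
  · obtain ⟨a1, a2⟩ := hhigh (by omega)
    have m1 : (i + p) % 2 ^ W = i + p := Nat.mod_eq_of_lt (by omega)
    have m2 : (i + p + 4) % 2 ^ W = i + p + 4 := Nat.mod_eq_of_lt a1
    rw [if_neg hbK, Nat.zero_mod] at g12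
    refine ⟨4 + 15, by norm_num, ?_⟩
    rw [hrun]
    simp [Halted, run, step, lookupProgram, BinOp.eval, g0, g1, g2, g8, g12, m1, m2, a2]

end WordRAM

namespace WordRAM

/-! ## Memory images -/

theorem memOf_append_left {L L' : List ℕ} {a : ℕ} (h : a < L.length) :
    memOf (L ++ L') a = memOf L a := by
  simp [memOf, List.getD_eq_getElem?_getD, List.getElem?_append_left h]

theorem memOf_append_right (L L' : List ℕ) (a : ℕ) :
    memOf (L ++ L') (a + L.length) = memOf L' a := by
  simp [memOf, List.getD_eq_getElem?_getD, List.getElem?_append_right (Nat.le_add_left _ a)]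

theorem memOf_map_range (f : ℕ → ℕ) {n a : ℕ} (h : a < n) :
    memOf ((List.range n).map f) a = f a := by
  simp [memOf, List.getD_eq_getElem?_getD, h]

/-- Arrays `f 0`, `f 1`, ... of lengths `len 0`, `len 1`, ... can be stored one after the other. -/
theorem exists_concat_arrays (f : ℕ → ℕ → ℕ) (len : ℕ → ℕ) (p : ℕ) :
    ∃ (F : List ℕ) (off : ℕ → ℕ), F.length = ∑ c ∈ Finset.range p, len c ∧
      (∀ a ∈ F, ∃ c y, a = f c y) ∧
      ∀ c < p, ∀ y < len c, off c + y < F.length ∧ memOf F (off c + y) = f c y := by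
  induction p with
  | zero => exact ⟨[], fun _ => 0, by simp⟩
  | succ p ih =>
    obtain ⟨F, off, hlen, hval, hoff⟩ := ih
    refine ⟨F ++ (List.range (len p)).map (f p), Function.update off p F.length, ?_, ?_, ?_⟩
    · simp [Finset.sum_range_succ, hlen]
    · intro a ha
      rcases List.mem_append.1 ha with ha | ha
      · exact hval a ha
      · obtain ⟨y, -, rfl⟩ := List.mem_map.1 ha
        exact ⟨p, y, rfl⟩
    · intro c hc y hy
      rcases Nat.lt_succ_iff_lt_or_eq.1 hc with hc | rfl
      · obtain ⟨h1, h2⟩ := hoff c hc y hy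
        rw [Function.update_of_ne hc.ne, memOf_append_left h1, List.length_append]
        exact ⟨by omega, h2⟩
      · rw [Function.update_self, add_comm F.length, memOf_append_right, memOf_map_range _ hy]
        simp only [List.length_append, List.length_map, List.length_range]
        exact ⟨by omega, trivial⟩

/-! ## The table -/

section table

variable {p : ℕ} {h : ℕ → ℕ} {A : ℕ → ℕ → ℕ}

/-- Each of the k steps starts at an entry at or above its height, where the answer does not change.
-/
theorem diagonal_shift (hstep : ∀ c y, h c ≤ y → A c y = A (c + 1) (y + 1)) {c y k : ℕ}
    (hk : ∀ j < k, h (c + j) ≤ y + j) : A c y = A (c + k) (y + k) := by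
  induction k with
  | zero => rfl
  | succ k ih =>
    rw [ih fun j hj => hk j (by omega), hstep _ _ (hk k (by omega)), add_assoc, add_assoc]

/-- If some value of a `p`-periodic function exceeds `t`, then so does one among any `p`
consecutive values. -/
theorem exists_next_gt (hp : 0 < p) (hh : ∀ c, h (c % p) = h c) {t c₀ : ℕ} (ht : t < h c₀)
    (c : ℕ) : ∃ k < p, t < h (c + k) ∧ ∀ j < k, h (c + j) ≤ t := by
  have hex : ∃ k, t < h (c + k) := by
    refine ⟨c₀ + p * c - c, ?_⟩
    have : c ≤ p * c := Nat.le_mul_of_pos_left c hp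
    rw [show c + (c₀ + p * c - c) = c₀ + p * c by omega, ← hh, Nat.add_mul_mod_self_left, hh]
    exact ht
  refine ⟨Nat.find hex, ?_, Nat.find_spec hex, fun j hj => not_lt.1 (Nat.find_min hex hj)⟩
  by_contra hge
  refine Nat.find_min hex (m := Nat.find hex - p) (by omega) ?_
  rw [← hh, ← Nat.add_mod_right, hh, show c + (Nat.find hex - p) + p = c + Nat.find hex by omega]
  exact Nat.find_spec hex

/-- `A c y` is the answer for the string of length `B + y` that ends in the residue class `c`; the
explicit nodes among these strings are those with `y < h c`. -/
theorem exists_lookup_table {B W n : ℕ} (hp : 0 < p)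
    (hh : ∀ c, h (c % p) = h c) (hA : ∀ c y, A (c % p) y = A c y)
    (hstep : ∀ c y, h c ≤ y → A c y = A (c + 1) (y + 1))
    (hAW : ∀ c y, A c y < 2 ^ W) (hpn : p ≤ n) (hBn : B ≤ n) (hnW : 2 * n < 2 ^ W)
    (hW : 16 ≤ 2 ^ W) (hsW : 4 + 4 * p + 4 * ∑ c ∈ Finset.range p, h c < 2 ^ W) :
    ∃ D : List ℕ, (∀ a ∈ D, a < 2 ^ W) ∧
      D.length ≤ 4 + 3 * p + 4 * ∑ c ∈ Finset.range p, h c ∧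
      ∀ i < p, ∀ m ≤ n, B + p ≤ m → AnswersWithin W lookupProgram 40 D i m
        (A (i + m) (m - B)) (if m - B < h (i + m) then 0 else 1) := by
  set s := ∑ c ∈ Finset.range p, h c with hs
  obtain ⟨cmax, hcmax, hmax⟩ := Finset.exists_max_image (Finset.range p) h ⟨0, by simpa⟩
  have hle : ∀ c, h c ≤ h cmax := fun c => by
    rw [← hh c]; exact hmax _ (Finset.mem_range.2 (Nat.mod_lt _ hp))
  have hmaxs : h cmax ≤ s := Finset.single_le_sum (fun _ _ => Nat.zero_le _) hcmax
  -- K = ⌈max h / p⌉, so b < K holds exactly when some height exceeds bp.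
  obtain ⟨K, hK1, hK2⟩ : ∃ K, h cmax ≤ K * p ∧ K * p < h cmax + p := by
    refine ⟨(h cmax + p - 1) / p, ?_, ?_⟩
    · have := Nat.lt_div_mul_add hp (a := h cmax + p - 1)
      omega
    · have := Nat.div_mul_le_self (h cmax + p - 1) p
      omega
  have hcand : ∀ b c, ∃ k, b < K → k < p ∧ b * p < h (c + k) ∧ ∀ j < k, h (c + j) ≤ b * p := by
    intro b c
    by_cases hb : b < K
    · have : (b + 1) * p ≤ K * p := Nat.mul_le_mul_right p hb
      rw [Nat.succ_mul] at this
      obtain ⟨k, hk⟩ := exists_next_gt hp hh (t := b * p) (c₀ := cmax) (by omega) c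
      exact ⟨k, fun _ => hk⟩
    · exact ⟨0, fun h => absurd h hb⟩
  choose κ hκ using hcand
  obtain ⟨F, off, hFlen, hFval, hoff⟩ := exists_concat_arrays A (fun c => 3 * h c) p
  rw [← Finset.mul_sum, ← hs] at hFlen
  -- The answer for start i and y = s. As s bounds all heights, every sufficiently high entry of
  -- this diagonal agrees with it.
  set Z : ℕ → ℕ := fun i => A (i + B + s) s with hZ
  -- The absolute address of entry k in the array of class c + k; adding y yields entry y + k.
  set N : ℕ → ℕ := fun a =>
    4 + 2 * p + K * p + off ((a % p + κ (a / p) (a % p)) % p) + κ (a / p) (a % p) with hN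
  set L0 : List ℕ := [p, B, K, 4 + 2 * p] with hL0
  set L1 : List ℕ := (List.range p).map h with hL1
  set L2 : List ℕ := (List.range p).map Z with hL2
  set L3 : List ℕ := (List.range (K * p)).map N with hL3
  have l0 : L0.length = 4 := rfl
  have l1 : L1.length = p := by simp [hL1]
  have l2 : L2.length = p := by simp [hL2]
  have l3 : L3.length = K * p := by simp [hL3]
  refine ⟨L0 ++ (L1 ++ (L2 ++ (L3 ++ F))), ?_, ?_, ?_⟩
  · intro a ha
    simp only [List.mem_append] at ha
    rcases ha with ha | ha | ha | ha | ha
    · have hKp : K ≤ K * p := Nat.le_mul_of_pos_right K hp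
      simp only [hL0, List.mem_cons, List.not_mem_nil, or_false] at ha
      rcases ha with rfl | rfl | rfl | rfl <;> omega
    · obtain ⟨c, -, rfl⟩ := List.mem_map.1 ha
      have := hle c
      omega
    · obtain ⟨c, -, rfl⟩ := List.mem_map.1 ha
      exact hAW _ _
    · obtain ⟨c, hc, rfl⟩ := List.mem_map.1 ha
      rw [List.mem_range] at hc
      obtain ⟨k1, k2, -⟩ := hκ (c / p) (c % p) (Nat.div_lt_of_lt_mul (by rwa [mul_comm]))
      rw [← hh] at k2
      -- An offset is known to lie inside F only if its array is nonempty, which the choice of k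
      -- ensures.
      have hpos : 0 < 3 * h ((c % p + κ (c / p) (c % p)) % p) := by omega
      have h1 := (hoff _ (Nat.mod_lt _ hp) 0 hpos).1
      simp only [hN]
      omega
    · obtain ⟨c, y, rfl⟩ := hFval a ha
      exact hAW _ _
  · simp only [List.length_append, l0, l1, l2, l3, hFlen]
    omega
  · intro i hi m hmn hBm
    set D := L0 ++ (L1 ++ (L2 ++ (L3 ++ F))) with hD
    have d1 : ∀ a < p, memOf D (a + 4) = h a := fun a ha => by
      rw [hD, ← l0, memOf_append_right, memOf_append_left (by omega), memOf_map_range _ ha]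
    have d2 : ∀ a < p, memOf D (a + p + 4) = Z a := fun a ha => by
      rw [hD, show a + p + 4 = a + L1.length + L0.length by omega, memOf_append_right,
        memOf_append_right, memOf_append_left (by omega), memOf_map_range _ ha]
    have d3 : ∀ a < K * p, memOf D (a + (4 + 2 * p)) = N a := fun a ha => by
      rw [hD, show a + (4 + 2 * p) = a + L2.length + L1.length + L0.length by omega,
        memOf_append_right, memOf_append_right, memOf_append_right, memOf_append_left (by omega),
        memOf_map_range _ ha]
    have d4 : ∀ a, memOf D (4 + 2 * p + K * p + a) = memOf F a := fun a => by
      rw [hD, show 4 + 2 * p + K * p + a = a + L3.length + L2.length + L1.length + L0.length by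
        omega, memOf_append_right, memOf_append_right, memOf_append_right, memOf_append_right]
    have hcp : (i + m) % p < p := Nat.mod_lt _ hp
    rw [← hh (i + m)]
    refine lookupProgram_answersWithin (p := p) (B := B) (K := K) (q := 4 + 2 * p) rfl rfl rfl rfl
      hW (by omega) (by omega) (by omega) (d1 _ hcp) (fun hb => ?_) (fun hb => ?_)
    · have hlt : (m - B) / p * p + (i + m) % p < K * p := by
        have : ((m - B) / p + 1) * p ≤ K * p := Nat.mul_le_mul_right p hb
        rw [Nat.succ_mul] at this
        omega
      have hm1 : ((m - B) / p * p + (i + m) % p) % p = (i + m) % p := by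
        rw [Nat.mul_add_mod_self_right, Nat.mod_mod]
      have hm2 : ((m - B) / p * p + (i + m) % p) / p = (m - B) / p := by
        rw [mul_comm, Nat.mul_add_div hp, Nat.div_eq_of_lt hcp, add_zero]
      obtain ⟨k1, k2, k3⟩ := hκ _ ((i + m) % p) hb
      have hy1 : (m - B) / p * p ≤ m - B := Nat.div_mul_le_self _ _
      have hy2 : m - B < (m - B) / p * p + p := Nat.lt_div_mul_add hp
      -- This is where B + p ≤ m is needed: b ≥ 1 keeps y + k below 3 h (c + k).
      have hb1 : 1 * p ≤ (m - B) / p * p :=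
        Nat.mul_le_mul_right p (Nat.div_pos (by omega) hp)
      set b := (m - B) / p with hbdef
      set c := (i + m) % p with hcdef
      set k := κ b c with hk
      rw [← hh] at k2
      obtain ⟨o1, o2⟩ := hoff _ (Nat.mod_lt (c + k) hp) (m - B + k) (by omega)
      refine ⟨_, by omega, d3 _ hlt, ?_, ?_⟩
      · simp only [hN, hm1, hm2, ← hk]
        omega
      · simp only [hN, hm1, hm2, ← hk]
        rw [show 4 + 2 * p + K * p + off ((c + k) % p) + k + (m - B) =
          4 + 2 * p + K * p + (off ((c + k) % p) + (m - B + k)) by omega, d4, o2, hA, ← hA (i + m)]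
        exact (diagonal_shift hstep fun j hj => (k3 j hj).trans (by omega)).symm
    · refine ⟨by omega, ?_⟩
      rw [d2 i hi]
      have hy : K * p ≤ m - B := (Nat.mul_le_mul_right p hb).trans (Nat.div_mul_le_self _ _)
      rcases le_total (m - B) s with hms | hms
      · rw [diagonal_shift (k := s - (m - B)) hstep fun j _ => (hle _).trans (by omega)]
        simp only [hZ]
        congr 1 <;> omega
      · simp only [hZ]
        rw [diagonal_shift (k := m - B - s) hstep fun j _ => (hle _).trans (by omega)]
        congr 1 <;> omega

end table

end WordRAM

/-! ## Loci along a periodic string -/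

/-- Some locus of the node `u`, if there is one. -/
noncomputable def locus {β : Type*} (S : Set (List β)) (u : List β) : List β :=
  open Classical in if h : ∃ v, IsLocus S u v then h.choose else []

theorem isLocus_locus {α : Type*} {docs : List (List α)} {u : List (α ⊕ ℕ)}
    (hu : u ∈ trieNodes (gstSuffixes docs)) :
    IsLocus (gstSuffixes docs) u (locus (gstSuffixes docs) u) := by
  have h := exists_isLocus (fun u hu => length_le_of_mem_trieNodes_gst hu) hu
  rw [locus, dif_pos h]
  exact h.choose_spec

theorem locus_eq_of_child {α : Type*} {docs : List (List α)} {u : List (α ⊕ ℕ)} {c : α ⊕ ℕ}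
    (hu : ¬ IsExplicitNode (gstSuffixes docs) u)
    (hc : u ++ [c] ∈ trieNodes (gstSuffixes docs)) :
    locus (gstSuffixes docs) u = locus (gstSuffixes docs) (u ++ [c]) :=
  (isLocus_locus (mem_trieNodes_of_prefix (List.prefix_append _ _) hc)).unique
    ((isLocus_locus hc).of_child hu hc)

section deepest

variable {α : Type*} (docs : List (List α)) (f : ℕ → α)

open Classical in
/-- The length of the longest prefix of `f i, f (i + 1), ...` that is represented in the
generalised suffix tree. -/
noncomputable def deepest (i : ℕ) : ℕ :=
  Nat.findGreatest (fun m => plain (window f i m) ∈ trieNodes (gstSuffixes docs))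
    (docs.map List.length).sum

/-- The locus of the string of length `m` that starts at `f i`, or of its longest represented
prefix. -/
noncomputable def windowLocus (i m : ℕ) : List (α ⊕ ℕ) :=
  locus (gstSuffixes docs) (plain (window f i (min m (deepest docs f i))))

variable {docs f}

theorem plain_window_mem_iff (hroot : [] ∈ trieNodes (gstSuffixes docs)) {i m : ℕ} :
    plain (window f i m) ∈ trieNodes (gstSuffixes docs) ↔ m ≤ deepest docs f i := by
  classical
  constructor
  · intro h
    have := length_le_of_plain_mem h
    rw [length_window] at this
    exact Nat.le_findGreatest this h
  · intro h
    refine mem_trieNodes_of_prefix ((window_prefix f h).map Sum.inl) ?_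
    exact Nat.findGreatest_spec
      (P := fun m => plain (window f i m) ∈ trieNodes (gstSuffixes docs)) (Nat.zero_le _)
      (by simpa [window, plain] using hroot)

theorem isLocus_windowLocus {i m : ℕ}
    (h : plain (window f i m) ∈ trieNodes (gstSuffixes docs)) :
    IsLocus (gstSuffixes docs) (plain (window f i m)) (windowLocus docs f i m) := by
  have hroot := mem_trieNodes_of_prefix (List.nil_prefix) h
  rw [windowLocus, min_eq_left ((plain_window_mem_iff hroot).1 h)]
  exact isLocus_locus h

theorem isExplicitNode_windowLocus (hroot : [] ∈ trieNodes (gstSuffixes docs)) (i m : ℕ) :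
    IsExplicitNode (gstSuffixes docs) (windowLocus docs f i m) :=
  (isLocus_locus ((plain_window_mem_iff hroot).2 (min_le_right _ _))).1

/-- If the longer window is not represented, both sides are cut off at the same deepest prefix. Thus
the invariance holds along the entire diagonal, even when the edge leaves r^∞. -/
theorem windowLocus_succ (hroot : [] ∈ trieNodes (gstSuffixes docs)) {i m : ℕ}
    (h : ¬ IsExplicitNode (gstSuffixes docs) (plain (window f i m))) :
    windowLocus docs f i m = windowLocus docs f i (m + 1) := by
  rcases le_or_gt (deepest docs f i) m with hm | hm
  · rw [windowLocus, windowLocus, min_eq_right hm, min_eq_right (hm.trans (Nat.le_succ _))]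
  · have hc : plain (window f i (m + 1)) ∈ trieNodes (gstSuffixes docs) :=
      (plain_window_mem_iff hroot).2 hm
    have e : plain (window f i (m + 1)) = plain (window f i m) ++ [Sum.inl (f (i + m))] := by
      simp [plain, window_concat]
    rw [windowLocus, windowLocus, min_eq_left hm.le, min_eq_left (Nat.succ_le_of_lt hm), e]
    exact locus_eq_of_child h (e ▸ hc)

theorem windowLocus_congr {i i' : ℕ} (h : ∀ j, f (i + j) = f (i' + j)) (m : ℕ) :
    windowLocus docs f i m = windowLocus docs f i' m := by
  have hw : window f i = window f i' := funext fun _ => window_congr h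
  rw [windowLocus, windowLocus, deepest, deepest, hw]

end deepest

/-! ## Explicit nodes by residue class of the end position -/

section classes

variable {α : Type*} (docs : List (List α)) (r : List α) (hr : 0 < r.length) (B : ℕ)

/-- The substring of length `B + y` of the infinite power of `r` that ends in the residue
class `c`. -/
def classWindow (c y : ℕ) : List α :=
  window (infPow r hr) (c + (r.length - 1) * (B + y)) (B + y)

/-- The least `y` for which the node of `classWindow r hr B c y` is not explicit. -/
noncomputable def explicitHeight (c : ℕ) : ℕ :=
  sInf {y | ¬ IsExplicitNode (gstSuffixes docs) (plain (classWindow r hr B c y))}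

theorem pred_mul_add {p : ℕ} (hp : 0 < p) (m : ℕ) : (p - 1) * m + m = p * m := by
  rw [← Nat.succ_mul]; congr 1; omega

theorem classWindow_start (i y : ℕ) :
    classWindow r hr B (i + (B + y)) y = window (infPow r hr) i (B + y) := by
  refine window_congr fun j => ?_
  have := pred_mul_add hr (B + y)
  rw [← infPow_add_mul r hr (i + j) (B + y)]
  congr 1; omega

theorem infPow_congr_mod {i i' : ℕ} (h : i ≡ i' [MOD r.length]) (j : ℕ) :
    infPow r hr (i + j) = infPow r hr (i' + j) := by
  rw [← infPow_mod, ← infPow_mod r hr (i' + j)]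
  congr 1
  exact h.add_right j

theorem classWindow_mod (c y : ℕ) :
    classWindow r hr B (c % r.length) y = classWindow r hr B c y :=
  window_congr fun j => infPow_congr_mod r hr ((Nat.mod_modEq c _).add_right _) j

theorem explicitHeight_mod (c : ℕ) :
    explicitHeight docs r hr B (c % r.length) = explicitHeight docs r hr B c := by
  simp only [explicitHeight, classWindow_mod]

theorem classWindow_succ (c y : ℕ) : ∃ a,
    classWindow r hr B c (y + 1) = a :: classWindow r hr B c y := by
  refine ⟨_, (window_succ _ _ _).trans (congrArg _ ?_)⟩
  refine window_congr fun j => ?_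
  rw [← infPow_add_mul r hr (c + (r.length - 1) * (B + y) + j) 1]
  congr 1
  rw [← add_assoc B, Nat.mul_succ]
  omega

variable {docs B}

/-- Within a class the strings are nested suffixes, so explicitness is downward closed in y; the
length bound on nodes makes it fail eventually. -/
theorem isExplicitNode_classWindow_iff (hB : 0 < B) {c y : ℕ} :
    IsExplicitNode (gstSuffixes docs) (plain (classWindow r hr B c y)) ↔
      y < explicitHeight docs r hr B c := by
  constructor
  · intro h
    have hall : ∀ k, ∀ y, IsExplicitNode (gstSuffixes docs) (plain (classWindow r hr B c (y + k))) →
        IsExplicitNode (gstSuffixes docs) (plain (classWindow r hr B c y)) := by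
      intro k
      induction k with
      | zero => exact fun y h => h
      | succ k ih =>
        intro y h
        obtain ⟨a, ha⟩ := classWindow_succ r hr B c (y + k)
        refine ih y (isExplicitNode_of_cons (a := a) ?_)
        rw [← ha]
        exact h
    by_contra hlt
    obtain ⟨k, hk⟩ := Nat.exists_eq_add_of_le (not_lt.1 hlt)
    rw [hk] at h
    refine Nat.sInf_mem (s := {y | ¬ IsExplicitNode (gstSuffixes docs)
      (plain (classWindow r hr B c y))}) ⟨(docs.map List.length).sum + 1, fun he => ?_⟩ (hall k _ h)
    have := length_le_of_plain_mem he.1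
    rw [classWindow, length_window] at this
    omega
  · intro h
    by_contra hne
    exact Nat.notMem_of_lt_sInf h hne

theorem explicitHeight_le (hB : 0 < B) (c : ℕ) :
    explicitHeight docs r hr B c ≤ (docs.map List.length).sum := by
  by_contra hlt
  have h := (isExplicitNode_classWindow_iff r hr hB).2 (not_le.1 hlt)
  have := length_le_of_plain_mem h.1
  rw [classWindow, length_window] at this
  omega

/-- The pairs (c, y) with y < h c inject into the explicit nodes of T_r: the length determines y,
and primitivity then determines c. -/
theorem sum_explicitHeight_le (hprim : IsPrimitive r) {ℓ : ℕ} (hℓ : ℓ ≤ 2 * B)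
    (hB : r.length ≤ B) :
    ∑ c ∈ Finset.range r.length, explicitHeight docs r hr B c ≤ numExplicitPeriodic docs r ℓ := by
  classical
  set n := (docs.map List.length).sum with hn
  have hfin : {u | u ∈ periodicPart docs r ℓ ∧ IsExplicitNode (gstSuffixes docs) u}.Finite := by
    refine (((Finset.range r.length) ×ˢ (Finset.range (n + 1))).image
      fun q => plain (window (infPow r hr) q.1 q.2)).finite_toSet.subset ?_
    rintro u ⟨⟨hu, x, i, rfl, hx, -⟩, -⟩
    refine Finset.mem_coe.2 (Finset.mem_image.2 ⟨(i % r.length, x.length), ?_, ?_⟩)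
    · have := length_le_of_plain_mem hu
      simp only [Finset.mem_product, Finset.mem_range]
      exact ⟨Nat.mod_lt _ hr, by omega⟩
    · conv_rhs => rw [hx.eq_window hr]
      exact congrArg plain (window_congr fun j => infPow_congr_mod r hr (Nat.mod_modEq _ _) j)
  rw [numExplicitPeriodic, Set.ncard_eq_toFinset_card _ hfin]
  have hcard : ∑ c ∈ Finset.range r.length, explicitHeight docs r hr B c =
      ((Finset.range r.length).sigma
        fun c => Finset.range (explicitHeight docs r hr B c)).card := by
    simp [Finset.card_sigma]
  rw [hcard]
  refine Finset.card_le_card_of_injOn (fun q => plain (classWindow r hr B q.1 q.2)) ?_ ?_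
  · rintro ⟨c, y⟩ hq
    simp only [Finset.coe_sigma, Set.mem_sigma_iff, Finset.mem_coe, Finset.mem_range] at hq
    have he := (isExplicitNode_classWindow_iff (docs := docs) r hr (hr.trans_le hB)).2 hq.2
    simp only [Set.Finite.coe_toFinset, Set.mem_ofPred_eq]
    refine ⟨⟨he.1, _, _, rfl, occursInPowAt_window hr _ _, ?_⟩, he⟩
    rw [classWindow, length_window]
    omega
  · rintro ⟨c, y⟩ hq ⟨c', y'⟩ hq' heq
    simp only [Finset.coe_sigma, Set.mem_sigma_iff, Finset.mem_coe, Finset.mem_range] at hq hq'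
    have heq' : classWindow r hr B c y = classWindow r hr B c' y' :=
      List.map_injective_iff.2 Sum.inl_injective heq
    have hy : y = y' := by
      have := congrArg List.length heq'
      simp only [classWindow, length_window] at this
      omega
    subst hy
    have hmod := hprim.window_inj (by omega) heq'
    have hc := Nat.ModEq.add_right_cancel' _ hmod
    rw [Nat.ModEq, Nat.mod_eq_of_lt hq.1, Nat.mod_eq_of_lt hq'.1] at hc
    rw [hc]

end classes

/-! ### The main theorem -/

theorem nat_le_mul_logb_add_one (p : ℕ) : (p : ℝ) ≤ p * Real.logb 2 p + 1 := by
  rcases Nat.lt_or_ge p 2 with h | h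
  · interval_cases p <;> simp
  · have h1 : (1 : ℝ) ≤ Real.logb 2 p := by
      rw [Real.le_logb_iff_rpow_le one_lt_two (by positivity)]
      simpa using (by exact_mod_cast h : (2 : ℝ) ≤ p)
    nlinarith [(Nat.cast_nonneg p : (0 : ℝ) ≤ p)]

theorem mainTheorem9 :
    ∃ (query : WordRAM.Program) (C κ : ℕ),
      ∀ (α : Type*) (docs : List (List α)) (r : List α) (ℓ W : ℕ)
        (addr : List (α ⊕ ℕ) → ℕ),
        IsPrimitive r →
        4 * r.length ≤ ℓ →
        -- the word size `W` is at least `κ log₂ n`, where `n` is the total length of the documents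
        (docs.map List.length).sum ^ κ ≤ 2 ^ W →
        -- the pointers to the explicit nodes are arbitrary distinct words
        Set.InjOn addr {v | IsExplicitNode (gstSuffixes docs) v} →
        (∀ v, IsExplicitNode (gstSuffixes docs) v → addr v < 2 ^ W) →
        ∃ D : List ℕ,
          (∀ a ∈ D, a < 2 ^ W) ∧
          (D.length : ℝ) ≤
            C * (r.length * Real.logb 2 r.length + numExplicitPeriodic docs r ℓ + 1) ∧
          ∀ (i : ℕ) (x : List α),
            i < r.length →
            OccursInPowAt r i x →
            3 * ℓ ≤ 4 * x.length →
            plain x ∈ trieNodes (gstSuffixes docs) →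
            ∃ v, IsLocus (gstSuffixes docs) (plain x) v ∧
              ∃ tag : ℕ,
                (IsExplicitNode (gstSuffixes docs) (plain x) → tag = 0) ∧
                (¬ IsExplicitNode (gstSuffixes docs) (plain x) → tag = 1) ∧
                WordRAM.AnswersWithin W query C D i x.length (addr v) tag := by
  refine ⟨WordRAM.lookupProgram, 40, 10, ?_⟩
  intro α docs r ℓ W addr hprim hℓ hW _ haddr
  have hr := hprim.length_pos
  have hlog := nat_le_mul_logb_add_one r.length
  by_cases hq : ∃ x : List α, 3 * ℓ ≤ 4 * x.length ∧ plain x ∈ trieNodes (gstSuffixes docs)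
  swap
  · refine ⟨[], by simp, ?_, fun i x _ _ hx hmem => absurd ⟨x, hx, hmem⟩ hq⟩
    have : (0 : ℝ) ≤ r.length := Nat.cast_nonneg _
    have : (0 : ℝ) ≤ numExplicitPeriodic docs r ℓ := Nat.cast_nonneg _
    simp only [List.length_nil, Nat.cast_zero]
    push_cast
    linarith
  obtain ⟨x₀, hx₀, hmem₀⟩ := hq
  have hx₀n := length_le_of_plain_mem hmem₀
  have hroot := mem_trieNodes_of_prefix List.nil_prefix hmem₀
  set n := (docs.map List.length).sum with hn
  obtain ⟨B, hB1, hB2⟩ : ∃ B, ℓ ≤ 2 * B ∧ 2 * B ≤ ℓ + 1 := ⟨(ℓ + 1) / 2, by omega, by omega⟩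
  have hBpos : 0 < B := by omega
  have hn3 : 3 ≤ n := by omega
  have hWn : 6561 * (n * n) ≤ 2 ^ W := by
    refine le_trans ?_ hW
    calc 6561 * (n * n) = 3 ^ 8 * (n * n) := by norm_num
      _ ≤ n ^ 8 * (n * n) := Nat.mul_le_mul_right _ (Nat.pow_le_pow_left hn3 8)
      _ = n ^ 10 := by ring
  have hnn : 3 * n ≤ n * n := Nat.mul_le_mul_right n hn3
  set f := infPow r hr with hf
  set h := explicitHeight docs r hr B with hh
  set A : ℕ → ℕ → ℕ := fun c y =>
    addr (windowLocus docs f (c + (r.length - 1) * (B + y)) (B + y)) with hA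
  have hsum : ∑ c ∈ Finset.range r.length, h c ≤ n * n := by
    calc ∑ c ∈ Finset.range r.length, h c ≤ ∑ _c ∈ Finset.range r.length, n :=
          Finset.sum_le_sum fun c _ => explicitHeight_le r hr hBpos c
      _ = r.length * n := by simp
      _ ≤ n * n := Nat.mul_le_mul_right _ (by omega)
  obtain ⟨D, hD1, hD2, hD3⟩ := WordRAM.exists_lookup_table (p := r.length) (h := h) (A := A)
    (B := B) (W := W) (n := n) hr (fun c => explicitHeight_mod docs r hr B c)
    (fun c y => congrArg addr (windowLocus_congr
      (fun j => infPow_congr_mod r hr ((Nat.mod_modEq c _).add_right _) j) _))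
    (fun c y hy => by
      have hne := (isExplicitNode_classWindow_iff (docs := docs) r hr hBpos).not.2 (not_lt.2 hy)
      refine congrArg addr ((windowLocus_succ hroot hne).trans
        (windowLocus_congr (fun j => ?_) _))
      rw [← infPow_add_mul r hr (c + (r.length - 1) * (B + y) + j) 1]
      congr 1
      rw [← add_assoc B, Nat.mul_succ (r.length - 1)]
      omega)
    (fun c y => haddr _ (isExplicitNode_windowLocus hroot _ _))
    (by omega) (by omega) (by omega) (by omega) (by omega)
  refine ⟨D, hD1, ?_, fun i x hi hx hxℓ hmem => ?_⟩
  · have hs := sum_explicitHeight_le (docs := docs) r hr hprim hB1 (by omega)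
    have hDle : D.length ≤ 4 + 3 * r.length + 4 * numExplicitPeriodic docs r ℓ :=
      hD2.trans (Nat.add_le_add_left (Nat.mul_le_mul_left 4 hs) _)
    have hDle' : (D.length : ℝ) ≤ 4 + 3 * r.length + 4 * numExplicitPeriodic docs r ℓ := by
      exact_mod_cast hDle
    have : (1 : ℝ) ≤ r.length := by exact_mod_cast hr
    have : (0 : ℝ) ≤ numExplicitPeriodic docs r ℓ := Nat.cast_nonneg _
    push_cast
    linarith
  · have hxw := hx.eq_window hr
    have hxn := length_le_of_plain_mem hmem
    obtain ⟨y, hy⟩ : ∃ y, x.length = B + y := Nat.exists_eq_add_of_le (by omega)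
    have hans := hD3 i hi x.length hxn (by omega)
    rw [hy] at hxw hans
    have hAeq : A (i + (B + y)) y = addr (windowLocus docs f i (B + y)) := by
      refine congrArg addr (windowLocus_congr (fun j => ?_) _)
      have := pred_mul_add hr (B + y)
      rw [hf, ← infPow_add_mul r hr (i + j) (B + y)]
      congr 1; omega
    have hexp : IsExplicitNode (gstSuffixes docs) (plain x) ↔ y < h (i + (B + y)) := by
      rw [hh, ← isExplicitNode_classWindow_iff r hr hBpos, classWindow_start, ← hxw]
    rw [Nat.add_sub_cancel_left, hAeq] at hans
    rw [hy]
    refine ⟨_, ?_, _, fun he => if_pos (hexp.1 he), fun he => if_neg fun hlt => he (hexp.2 hlt),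
      hans⟩
    rw [hxw] at hmem ⊢
    exact isLocus_windowLocus hmem
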